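/- All groups are abelian. For an abelian topological group $G$ let $G^\wedge$ be the group of continuous homomorphisms (characters) $\chi : G \to \mathbb{T} = \{z \in \mathbb{C} : |z| = 1\}$ with the compact-open topology, $G^{\wedge\wedge} = (G^\wedge)^\wedge$, and let $\alpha_G : G \to G^{\wedge\wedge}$, $\alpha_G(g)(\chi) = \chi(g)$, be the canonical homomorphism; $G$ is called reflexive if $\alpha_G$ is a topological isomorphism (onto $G^{\wedge\wedge}$). A set $A \subseteq G$ is called quasi-convex if for every $g \in G \setminus A$ there is $\chi \in G^\wedge$ with $\operatorname{Re} \chi(h) \geq 0$ for all $h \in A$ and $\operatorname{Re} \chi(g) < 0$; $G$ is called locally quasi-convex if its neutral element has a neighbourhood basis consisting of quasi-convex sets. Proposition 3. Let $G$ be a Polish abelian group, and let $H$ be the closure of $\alpha_G(G)$ in $G^{\wedge\wedge}$. 1. If $H = G^{\wedge\wedge}$, then $G^\wedge$ and $G^{\wedge\wedge}$ are reflexive. 2. If $G$ is locally quasi-convex and $H = G^{\wedge\wedge}$, then $G$ is reflexive. -/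

import Mathlib

open Topology

/-- Evaluation of characters at a fixed element `g`, as a character of the dual group `G^∧`.
Here `PontryaginDual G` is the group of continuous homomorphisms `G → Circle` with the
compact-open topology. -/
noncomputable def evalCharacter (G : Type*) [CommGroup G] [TopologicalSpace G] (g : G) :
    PontryaginDual (PontryaginDual G) :=
  ({ toFun := fun χ : PontryaginDual G => χ g
     map_one' := rfl
     map_mul' := fun _ _ => rfl
     continuous_toFun :=
      continuous_eval_const (F := G →ₜ* Circle) g } : PontryaginDual G →ₜ* Circle)

/-- The canonical homomorphism `α_G : G → G^∧∧`, `g ↦ (χ ↦ χ g)`. -/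
noncomputable def canonicalHom (G : Type*) [CommGroup G] [TopologicalSpace G] :
    G →* PontryaginDual (PontryaginDual G) where
  toFun := evalCharacter G
  map_one' := PontryaginDual.ext fun χ => map_one χ
  map_mul' g h := PontryaginDual.ext fun χ => map_mul χ g h

/-- `G` is (Pontryagin) reflexive if the canonical homomorphism `α_G : G → G^∧∧` is a topological
isomorphism, i.e. a homomorphism that is a homeomorphism onto the whole bidual. -/
def IsReflexive (G : Type*) [CommGroup G] [TopologicalSpace G] : Prop :=
  IsHomeomorph (canonicalHom G)

/-- The polar `A^▷ = {χ ∈ G^∧ : Re χ(h) ≥ 0 for all h ∈ A}` of a subset `A` of `G`. -/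
def polarSet {G : Type*} [CommGroup G] [TopologicalSpace G] (A : Set G) :
    Set (PontryaginDual G) :=
  {χ | ∀ h ∈ A, 0 ≤ (χ h : ℂ).re}

/-- `A ⊆ G` is quasi-convex if each `g ∉ A` is separated from `A` by some `χ ∈ A^▷` with
`Re χ(g) < 0`. -/
def IsQuasiConvex {G : Type*} [CommGroup G] [TopologicalSpace G] (A : Set G) : Prop :=
  ∀ g, g ∉ A → ∃ χ ∈ polarSet A, (χ g : ℂ).re < 0

/-- `G` is locally quasi-convex if the neutral element has a neighbourhood basis consisting of
quasi-convex sets. -/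
def IsLocallyQuasiConvex (G : Type*) [CommGroup G] [TopologicalSpace G] : Prop :=
  (𝓝 (1 : G)).HasBasis (fun U : Set G => U ∈ 𝓝 (1 : G) ∧ IsQuasiConvex U) id

/-!
The canonical homomorphism of any metrizable group `G` is continuous, because a metrizable space is
compactly generated and evaluation is jointly continuous on compact sets
(`continuous_canonicalHom`). For metrizable `G` the canonical homomorphism of `G^∧` is also
continuous (`continuous_canonicalHom_dual`). It is so on each of the polars of neighbourhoods of
`1 : G`, which are compact by the Arzelà-Ascoli theorem (`isCompact_polarSet`), and by a
Banach-Dieudonné argument these polars determine the neighbourhoods of `1` in `G^∧`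
(`mem_nhds_one_of_forall_polarSet`).

The dual `(α_G)^∧ : G^∧∧∧ → G^∧` is always a left inverse of `α_{G^∧}`. If `α_G` has dense range,
then `(α_G)^∧` is injective, so the two maps are mutually inverse and `G^∧` is reflexive
(`isReflexive_dual_of_denseRange`). Reflexivity passes to the dual group (`IsReflexive.dual`),
which gives that of `G^∧∧`.

If `G` is locally quasi-convex, the compact polars of quasi-convex neighbourhoods of `1` show that
`α_G` is an embedding (`isInducing_canonicalHom`). A Polish group embedded as a dense subgroup of a
Hausdorff group is the whole group: it is a dense `Gδ` set there, and meets all of its translates by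
Baire's theorem (`surjective_of_isInducing_of_denseRange`).
-/

open Set Filter TopologicalSpace

/-! ### Arcs of the circle -/

lemma Circle.re_pos_of_re_nonneg_of_re_mul_self_nonneg {z : Circle} (h₁ : 0 ≤ (z : ℂ).re)
    (h₂ : 0 ≤ ((z * z : Circle) : ℂ).re) : 0 < (z : ℂ).re := by
  have hz : (z : ℂ).re * (z : ℂ).re + (z : ℂ).im * (z : ℂ).im = 1 := by
    rw [← Complex.normSq_apply, Circle.normSq_coe]
  rw [Circle.coe_mul, Complex.mul_re] at h₂
  rcases h₁.eq_or_lt with h | h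
  · nlinarith
  · exact h

lemma Circle.mem_centeredArc_pi_div_two_iff {z : Circle} :
    z ∈ Circle.centeredArc (Real.pi / 2) ↔ 0 < (z : ℂ).re := by
  rw [Circle.mem_centeredArc (by linarith [Real.pi_pos]), Complex.abs_arg_lt_pi_div_two_iff]
  simp

lemma Circle.mem_centeredArc_div_two_pow_succ {z : Circle} {n : ℕ}
    (h₁ : z ∈ Circle.centeredArc (Real.pi / 2 ^ (n + 1)))
    (h₂ : z * z ∈ Circle.centeredArc (Real.pi / 2 ^ (n + 1))) :
    z ∈ Circle.centeredArc (Real.pi / 2 ^ (n + 1 + 1)) := by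
  have h := Circle.mem_centeredArc_div (n := 2) (s := Real.pi / 2 ^ (n + 1))
    (div_le_self Real.pi_pos.le (one_le_pow₀ one_le_two))
    (Circle.centeredArc_mono (div_le_div_of_nonneg_left Real.pi_pos.le (by norm_num)
      (by simpa using le_self_pow₀ (one_le_two (α := ℝ)) n.succ_ne_zero)) h₁)
    (by rwa [sq])
  rwa [div_div, Nat.cast_ofNat, ← pow_succ] at h

lemma Circle.continuous_re : Continuous fun z : Circle ↦ (z : ℂ).re :=
  Complex.continuous_re.comp continuous_induced_dom

/-! ### Polars -/

section Polar

variable {G : Type*} [CommGroup G] [TopologicalSpace G]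

lemma mem_polarSet {A : Set G} {χ : PontryaginDual G} :
    χ ∈ polarSet A ↔ ∀ h ∈ A, 0 ≤ (χ h : ℂ).re :=
  Iff.rfl

lemma polarSet_anti {A B : Set G} (h : A ⊆ B) : polarSet B ⊆ polarSet A :=
  fun _ hχ g hg ↦ hχ g (h hg)

lemma polarSet_union (A B : Set G) : polarSet (A ∪ B) = polarSet A ∩ polarSet B := by
  ext χ
  simp only [mem_inter_iff, mem_polarSet, mem_union, or_imp, forall_and]

lemma continuous_re_eval (g : G) : Continuous fun χ : PontryaginDual G ↦ (χ g : ℂ).re :=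
  Circle.continuous_re.comp <|
    continuous_eval_const (F := G →ₜ* Circle) g

lemma isClosed_polarSet (A : Set G) : IsClosed (polarSet A) := by
  simp only [polarSet, ofPred_forall]
  exact isClosed_iInter fun g ↦ isClosed_iInter fun _ ↦
    isClosed_le continuous_const (continuous_re_eval g)

lemma polarSet_univ : polarSet (univ : Set G) = {1} := by
  ext χ
  refine ⟨fun h ↦ PontryaginDual.ext fun g ↦ ?_, ?_⟩
  · refine Circle.eq_one_of_forall_pow_mem_centeredArc_pi_div_two fun n _ ↦ ?_
    rw [Circle.mem_centeredArc_pi_div_two_iff]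
    refine Circle.re_pos_of_re_nonneg_of_re_mul_self_nonneg ?_ ?_
    · simpa using h (g ^ n) (mem_univ _)
    · simpa using h (g ^ n * g ^ n) (mem_univ _)
  · rintro rfl g _
    simp

/-- The set of characters with positive real part on a compact set is open. -/
lemma isOpen_re_pos_of_isCompact {K : Set G} (hK : IsCompact K) :
    IsOpen {χ : PontryaginDual G | ∀ g ∈ K, 0 < (χ g : ℂ).re} :=
  isOpen_induced (f := (ContinuousMonoidHom.toContinuousMap : (G →ₜ* Circle) → C(G, Circle)))
    (ContinuousMap.isOpen_setOfPred_mapsTo hK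
      (isOpen_lt continuous_const Circle.continuous_re :
        IsOpen {z : Circle | 0 < (z : ℂ).re}))

lemma polarSet_mem_nhds_one {K : Set G} (hK : IsCompact K) :
    polarSet K ∈ 𝓝 (1 : PontryaginDual G) :=
  mem_of_superset ((isOpen_re_pos_of_isCompact hK).mem_nhds fun g _ ↦ by simp)
    fun _ hχ g hg ↦ (hχ g hg).le

variable [IsTopologicalGroup G]

lemma equicontinuous_of_re_nonneg {U : Set G} (hU : U ∈ 𝓝 (1 : G)) :
    Equicontinuous fun f : {f : G →* Circle | ∀ g ∈ U, 0 ≤ (f g : ℂ).re} ↦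
      ((f : G →* Circle) : G → Circle) := by
  refine equicontinuous_of_equicontinuousAt_one _ ?_
  -- A sequence of neighbourhoods of `1` such that each of them and the squares of its
  -- elements lie in the previous one.
  obtain ⟨V, hV0, hV⟩ : ∃ V : ℕ → Set G, V 0 ⊆ U ∧ (∀ n, V n ∈ 𝓝 (1 : G) ∧
      ∀ x ∈ V (n + 1), x ∈ V n ∧ x * x ∈ V n) := by
    have step (S : {S : Set G // S ∈ 𝓝 (1 : G)}) :
        ∃ T : {S : Set G // S ∈ 𝓝 (1 : G)}, ∀ x ∈ T.1, x ∈ S.1 ∧ x * x ∈ S.1 := by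
      have h : Tendsto (fun x : G ↦ x * x) (𝓝 1) (𝓝 1) :=
        Continuous.tendsto' (by fun_prop) _ _ (mul_one 1)
      exact ⟨⟨_, inter_mem S.2 (h S.2)⟩, fun x hx ↦ hx⟩
    choose T hT using step
    let V : ℕ → {S : Set G // S ∈ 𝓝 (1 : G)} := Nat.rec ⟨U, hU⟩ fun _ ↦ T
    exact ⟨fun n ↦ (V n).1, subset_rfl, fun n ↦ ⟨(V n).2, hT (V n)⟩⟩
  have key (f : G →* Circle) (hf : ∀ g ∈ U, 0 ≤ (f g : ℂ).re) (n : ℕ) :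
      ∀ x ∈ V (n + 1), f x ∈ Circle.centeredArc (Real.pi / 2 ^ (n + 1)) := by
    induction n with
    | zero =>
      intro x hx
      obtain ⟨h₁, h₂⟩ := (hV 0).2 x hx
      rw [zero_add, pow_one, Circle.mem_centeredArc_pi_div_two_iff]
      exact Circle.re_pos_of_re_nonneg_of_re_mul_self_nonneg (hf x (hV0 h₁))
        (map_mul f x x ▸ hf _ (hV0 h₂))
    | succ n ih =>
      intro x hx
      obtain ⟨h₁, h₂⟩ := (hV (n + 1)).2 x hx
      exact Circle.mem_centeredArc_div_two_pow_succ (ih x h₁) (map_mul f x x ▸ ih _ h₂)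
  rw [Circle.hasBasis_centeredArc_div_two_pow.uniformity_of_nhds_one.equicontinuousAt_iff_right]
  refine fun n _ ↦ mem_of_superset (hV (n + 1)).1 fun x hx ⟨f, hf⟩ ↦ ?_
  change f x / f 1 ∈ Circle.centeredArc _
  rw [map_one, div_one]
  exact key f hf n x hx

/-- The Banach-Alaoglu theorem for topological groups: since the characters in the polar of a
neighbourhood of `1` are equicontinuous, this is a case of the Arzelà-Ascoli theorem. -/
theorem isCompact_polarSet {U : Set G} (hU : U ∈ 𝓝 (1 : G)) : IsCompact (polarSet U) := by
  let S₁ : Set (G →* Circle) := {f | ∀ g ∈ U, 0 ≤ (f g : ℂ).re}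
  have h : Equicontinuous ((↑) : S₁ → G → Circle) := equicontinuous_of_re_nonneg hU
  let S₂ : Set (G →ₜ* Circle) := polarSet U
  let S₃ : Set C(G, Circle) := ContinuousMonoidHom.toContinuousMap '' S₂
  have hS : ContinuousMap.toFun '' S₃ = ((↑) : (G →* Circle) → G → Circle) '' S₁ := by
    ext φ
    constructor
    · rintro ⟨-, ⟨f, hf, rfl⟩, rfl⟩
      exact ⟨f, hf, rfl⟩
    · rintro ⟨f, hf, rfl⟩
      exact ⟨_, ⟨⟨f, h.continuous ⟨f, hf⟩⟩, hf, rfl⟩, rfl⟩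
  have hcl : IsClosed (ContinuousMap.toFun '' S₃) := by
    have : ContinuousMap.toFun '' S₃ = {φ : G → Circle | ∀ g ∈ U, 0 ≤ (φ g : ℂ).re} ∩
        range ((↑) : (G →* Circle) → G → Circle) := by
      rw [hS]
      ext φ
      exact ⟨fun ⟨f, hf, h⟩ ↦ h ▸ ⟨hf, f, rfl⟩, fun ⟨h, f, hf⟩ ↦ ⟨f, by subst hf; exact h, hf⟩⟩
    rw [this]
    refine IsClosed.inter ?_ (MonoidHom.isClosed_range_coe G Circle)
    simp only [ofPred_forall]
    exact isClosed_iInter fun g ↦ isClosed_iInter fun _ ↦ isClosed_le continuous_const <|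
      Circle.continuous_re.comp <| continuous_apply g
  have h₃ : Equicontinuous ((↑) : S₃ → G → Circle) := by
    rw [equicontinuous_iff_range, ← image_eq_range] at h ⊢
    rw [← hS] at h
    exact h
  exact (ContinuousMonoidHom.isInducing_toContinuousMap G Circle).isCompact_iff.mpr
    (ArzelaAscoli.isCompact_of_equicontinuous S₃ hcl.isCompact h₃)

end Polar

/-! ### The Banach-Dieudonné theorem -/

section BanachDieudonne

variable {G : Type*} [CommGroup G] [TopologicalSpace G] [IsTopologicalGroup G]

/-- One step of the construction in `mem_nhds_one_of_forall_polarSet`. The hypothesis `hW` says that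
`W` is relatively open in the polar of `V`; finiteness comes from compactness of that polar. -/
lemma exists_finite_polarSet_subset {U V E : Set G} (hV : V ∈ 𝓝 (1 : G))
    {W : Set (PontryaginDual G)} (hW : ∃ O, IsOpen O ∧ polarSet V ∩ O = polarSet V ∩ W)
    (hE : polarSet E ∩ polarSet U ⊆ W) :
    ∃ F ⊆ U, F.Finite ∧ polarSet (E ∪ F) ∩ polarSet V ⊆ W := by
  obtain ⟨O, hO, hOW⟩ := hW
  have hK : IsCompact (polarSet V ∩ polarSet E ∩ Oᶜ) :=
    ((isCompact_polarSet hV).inter_right (isClosed_polarSet E)).inter_right hO.isClosed_compl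
  obtain ⟨F, hFU, hF, hcov⟩ := hK.elim_finite_subcover_image (b := U)
    (c := fun g ↦ {χ : PontryaginDual G | (χ g : ℂ).re < 0})
    (fun g _ ↦ isOpen_lt (continuous_re_eval g) continuous_const) (by
      rintro χ ⟨⟨hχV, hχE⟩, hχO⟩
      by_contra hχ
      simp only [mem_iUnion, mem_ofPred_eq, exists_prop, not_exists, not_and, not_lt] at hχ
      exact hχO (hOW.symm.subset ⟨hχV, hE ⟨hχE, hχ⟩⟩).2)
  refine ⟨F, hFU, hF, fun χ ⟨hχ, hχV⟩ ↦ ?_⟩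
  rw [polarSet_union] at hχ
  by_cases hχO : χ ∈ O
  · exact (hOW.subset ⟨hχV, hχO⟩).2
  · obtain ⟨g, hg, hlt⟩ := mem_iUnion₂.mp (hcov ⟨⟨hχV, hχ.1⟩, hχO⟩)
    exact absurd (hχ.2 g hg) (not_le.mpr hlt)

/-- The Banach-Dieudonné theorem for topological groups. A compact set
`K = {1} ∪ F₀ ∪ F₁ ∪ ⋯` with polar inside `W` is built from finite sets `Fₙ ⊆ Uₙ`, where `Uₙ` is a
decreasing neighbourhood basis of `1`. -/
theorem mem_nhds_one_of_forall_polarSet [FirstCountableTopology G] {W : Set (PontryaginDual G)}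
    (h1 : 1 ∈ W)
    (hW : ∀ V ∈ 𝓝 (1 : G), ∃ O, IsOpen O ∧ polarSet V ∩ O = polarSet V ∩ W) :
    W ∈ 𝓝 (1 : PontryaginDual G) := by
  obtain ⟨B, hB⟩ := (𝓝 (1 : G)).exists_antitone_basis
  -- The whole group comes first, since its polar `{1}` starts the induction.
  let U : ℕ → Set G := fun n ↦ Nat.casesOn n univ B
  have hU : ∀ n, U n ∈ 𝓝 (1 : G) := by
    rintro (_ | n)
    · exact univ_mem
    · exact hB.mem n
  have hUanti : ∀ m n, m ≤ n → U n ⊆ U m := by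
    rintro (_ | m) (_ | n) h
    · exact subset_rfl
    · exact subset_univ _
    · exact absurd h (by simp)
    · exact hB.antitone (Nat.succ_le_succ_iff.mp h)
  have step (n : ℕ) (E : {E : Set G // E.Finite ∧ polarSet E ∩ polarSet (U n) ⊆ W}) :
      ∃ E' : {E : Set G // E.Finite ∧ polarSet E ∩ polarSet (U (n + 1)) ⊆ W},
        E.1 ⊆ E'.1 ∧ E'.1 ⊆ E.1 ∪ U n := by
    obtain ⟨F, hFU, hF, hFW⟩ := exists_finite_polarSet_subset (hU (n + 1)) (hW _ (hU (n + 1))) E.2.2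
    exact ⟨⟨E.1 ∪ F, E.2.1.union hF, hFW⟩, subset_union_left, union_subset_union_right _ hFU⟩
  choose next hnext hnextU using step
  let E : (n : ℕ) → {E : Set G // E.Finite ∧ polarSet E ∩ polarSet (U n) ⊆ W} :=
    Nat.rec ⟨∅, finite_empty, by
      rintro χ ⟨-, hχ⟩
      rw [show χ = 1 from polarSet_univ.subset hχ]
      exact h1⟩ next
  have hEmono : Monotone fun n ↦ (E n).1 := monotone_nat_of_le_succ fun n ↦ hnext n (E n)
  have hEU (n m : ℕ) : (E m).1 ⊆ (E n).1 ∪ U n := by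
    induction m with
    | zero => exact empty_subset _
    | succ m ih =>
      rcases le_total (m + 1) n with h | h
      · exact (hEmono h).trans subset_union_left
      · rcases h.eq_or_lt with rfl | h
        · exact subset_union_left
        · exact (hnextU m (E m)).trans (union_subset ih
            ((hUanti n m (Nat.lt_succ_iff.mp h)).trans subset_union_right))
  let F : Set G := ⋃ n, (E n).1
  have hFlim : Tendsto ((↑) : F → G) cofinite (𝓝 1) := by
    refine hB.tendsto_right_iff.mpr fun n _ ↦ ?_
    refine ((E (n + 1)).2.1.preimage Subtype.val_injective.injOn).subset fun x hx ↦ ?_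
    obtain ⟨m, hm⟩ := mem_iUnion.mp x.2
    exact (hEU (n + 1) m hm).resolve_right hx
  have hK : IsCompact (insert 1 F) := by
    simpa using hFlim.isCompact_insert_range_of_cofinite
  refine mem_of_superset (polarSet_mem_nhds_one hK) fun χ hχ ↦ ?_
  -- By continuity, every character lies in the polar of some member of the basis.
  have hpos : {g : G | 0 < (χ g : ℂ).re} ∈ 𝓝 (1 : G) :=
    (isOpen_lt continuous_const <| Circle.continuous_re.comp <|
      map_continuous χ).mem_nhds (by simp)
  obtain ⟨n, hn⟩ := hB.mem_iff.mp hpos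
  exact (E (n + 1)).2.2 ⟨polarSet_anti ((subset_iUnion (fun n ↦ (E n).1) (n + 1)).trans
    (subset_insert 1 F)) hχ, fun g hg ↦ (show 0 < (χ g : ℂ).re from hn hg).le⟩

end BanachDieudonne

/-! ### Continuity of the canonical homomorphism -/

section Continuity

variable {G : Type*} [CommGroup G] [TopologicalSpace G]

/-- The canonical homomorphism is continuous along every continuous map from a compact Hausdorff
space, by joint continuity of the evaluation `C(X, Circle) × X → Circle`. -/
lemma continuous_canonicalHom_comp {X : Type*} [TopologicalSpace X] [CompactSpace X]
    [T2Space X] {f : X → G} (hf : Continuous f) : Continuous fun x ↦ canonicalHom G (f x) := by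
  refine ContinuousMonoidHom.continuous_of_continuous_uncurry
    (B := PontryaginDual G) (C := Circle) (fun x ↦ canonicalHom G (f x)) ?_
  have h : Continuous fun χ : PontryaginDual G ↦
      (ContinuousMonoidHom.toContinuousMap (show G →ₜ* Circle from χ)).comp ⟨f, hf⟩ :=
    (ContinuousMap.continuous_precomp ⟨f, hf⟩).comp
      (ContinuousMonoidHom.isInducing_toContinuousMap G Circle).continuous
  exact (h.comp continuous_snd).eval continuous_fst

theorem continuous_canonicalHom [SequentialSpace G] : Continuous (canonicalHom G) :=
  continuous_from_uCompactlyGeneratedSpace.{0} _ fun S g ↦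
    have : T2Space S := S.is_hausdorff
    have : CompactSpace S := S.is_compact
    continuous_canonicalHom_comp g.continuous

theorem continuous_canonicalHom_dual [IsTopologicalGroup G] [FirstCountableTopology G] :
    Continuous (canonicalHom (PontryaginDual G)) := by
  refine continuous_of_tendsto_nhds_one _ fun N hN ↦ ?_
  obtain ⟨O, hON, hO, h1⟩ := mem_nhds_iff.mp hN
  refine mem_of_superset (mem_nhds_one_of_forall_polarSet
    (W := canonicalHom (PontryaginDual G) ⁻¹' O) ?_ fun V hV ↦ ?_) (preimage_mono hON)
  · simpa using h1
  · have : CompactSpace (polarSet V) := isCompact_iff_compactSpace.mp (isCompact_polarSet hV)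
    have h := continuous_canonicalHom_comp (continuous_subtype_val (p := (· ∈ polarSet V)))
    obtain ⟨O', hO', h'⟩ := isOpen_induced_iff.mp (hO.preimage h)
    refine ⟨O', hO', ?_⟩
    exact Subtype.preimage_coe_eq_preimage_coe_iff.mp h'

end Continuity

/-! ### Reflexivity of dual groups -/

section Reflexive

/-- If the canonical homomorphisms of `G` and `G^∧` are continuous and the first one has dense
range, then the dual of the first one inverts the second one. -/
theorem isReflexive_dual_of_denseRange {G : Type*} [CommGroup G] [TopologicalSpace G]
    (hc : Continuous (canonicalHom G)) (hd : DenseRange (canonicalHom G))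
    (hc' : Continuous (canonicalHom (PontryaginDual G))) : IsReflexive (PontryaginDual G) := by
  let D := PontryaginDual.map (⟨canonicalHom G, hc⟩ : G →ₜ* PontryaginDual (PontryaginDual G))
  have hD : Function.LeftInverse D (canonicalHom (PontryaginDual G)) := fun χ ↦ rfl
  have hDinj : Function.Injective D := fun φ ψ h ↦ DFunLike.coe_injective <|
    hd.equalizer (map_continuous φ) (map_continuous ψ) (funext fun g ↦ DFunLike.congr_fun h g)
  exact isHomeomorph_iff_exists_inverse.mpr
    ⟨hc', D, hD, hD.rightInverse_of_injective hDinj, map_continuous D⟩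

/-- The canonical homomorphism of the dual of a reflexive group is the dual of the inverse of
`canonicalHom G`, hence continuous. -/
theorem IsReflexive.dual {G : Type*} [CommGroup G] [TopologicalSpace G] (h : IsReflexive G) :
    IsReflexive (PontryaginDual G) := by
  refine isReflexive_dual_of_denseRange h.continuous h.surjective.denseRange ?_
  let e := MulEquiv.ofBijective (canonicalHom G) h.bijective
  have he : Continuous e.symm := (h.homeomorph (canonicalHom G)).symm.continuous
  have key : canonicalHom (PontryaginDual G) =
      PontryaginDual.map (⟨e.symm.toMonoidHom, he⟩ : PontryaginDual (PontryaginDual G) →ₜ* G) := by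
    refine MonoidHom.ext fun χ ↦ PontryaginDual.ext fun φ ↦ ?_
    obtain ⟨g, rfl⟩ := h.surjective φ
    exact congrArg χ (e.symm_apply_apply g).symm
  exact key ▸ map_continuous (PontryaginDual.map _)

end Reflexive

/-! ### Density and completeness of Polish groups -/

section Completeness

/-- A limit of images of points of a complete metric space, along preimages of arbitrarily small
diameter, is an image. -/
lemma mem_range_of_forall_exists_dist_lt {X Y : Type*} [MetricSpace X] [CompleteSpace X]
    [TopologicalSpace Y] [T2Space Y] {e : X → Y} (hc : Continuous e) (hd : DenseRange e) {y : Y}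
    (hy : ∀ n : ℕ, ∃ W, IsOpen W ∧ y ∈ W ∧
      ∀ a b, e a ∈ W → e b ∈ W → dist a b < 1 / ((n : ℝ) + 1)) : y ∈ range e := by
  have : NeBot (comap e (𝓝 y)) := comap_neBot_iff_frequently.mpr
    (mem_closure_iff_frequently.mp (hd y) |>.mono fun _ h ↦ h)
  have hcau : Cauchy (comap e (𝓝 y)) := by
    refine Metric.cauchy_iff.mpr ⟨this, fun ε hε ↦ ?_⟩
    obtain ⟨n, hn⟩ := exists_nat_one_div_lt hε
    obtain ⟨W, hW, hyW, h⟩ := hy n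
    exact ⟨e ⁻¹' W, preimage_mem_comap (hW.mem_nhds hyW),
      fun a ha b hb ↦ (h a b ha hb).trans hn⟩
  obtain ⟨x, hx⟩ := CompleteSpace.complete hcau
  exact ⟨x, tendsto_nhds_unique ((hc.tendsto x).mono_left hx) tendsto_comap⟩

/-- A Polish group is complete. The image of `e` is a dense `Gδ` set by completeness of a metric on
`G`, so by Baire's theorem it meets each of its translates. -/
theorem surjective_of_isInducing_of_denseRange {G X : Type*} [Group G] [TopologicalSpace G]
    [PolishSpace G] [Group X] [TopologicalSpace X] [IsTopologicalGroup X] [T2Space X]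
    {e : G →* X} (he : IsInducing e) (hd : DenseRange e) : Function.Surjective e := by
  intro x
  let := upgradeIsCompletelyMetrizable G
  let S : ℕ → Set X := fun n ↦ {y | ∃ W, IsOpen W ∧ y ∈ W ∧
      ∀ a b, e a ∈ W → e b ∈ W → dist a b < 1 / ((n : ℝ) + 1)}
  have hSo (n : ℕ) : IsOpen (S n) := isOpen_iff_forall_mem_open.mpr
    fun y ⟨W, hW, hyW, h⟩ ↦ ⟨W, fun z hz ↦ ⟨W, hW, hz, h⟩, hW, hyW⟩
  have hSr (n : ℕ) (g : G) : e g ∈ S n := by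
    have hpos : (0 : ℝ) < 1 / ((n : ℝ) + 1) / 2 := by positivity
    obtain ⟨W, hW, hWb⟩ := he.isOpen_iff.mp (Metric.isOpen_ball (x := g) (ε := _ / 2))
    have hball {a : G} (ha : e a ∈ W) : dist a g < 1 / ((n : ℝ) + 1) / 2 :=
      Metric.mem_ball.mp (hWb ▸ ha)
    refine ⟨W, hW, show g ∈ e ⁻¹' W from hWb ▸ Metric.mem_ball_self hpos, fun a b ha hb ↦ ?_⟩
    calc dist a b ≤ dist a g + dist b g := dist_triangle_right a b g
      _ < _ := by linarith [hball ha, hball hb]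
  have hopen (n : ℕ) : IsOpen {g : G | x * e g ∈ S n} :=
    (hSo n).preimage (continuous_const.mul he.continuous)
  have hdense (n : ℕ) : Dense {g : G | x * e g ∈ S n} := by
    refine dense_iff_inter_open.mpr fun V hV ⟨v, hv⟩ ↦ ?_
    obtain ⟨W, hW, rfl⟩ := he.isOpen_iff.mp hV
    have hO : IsOpen ((x * ·) '' W) := (Homeomorph.mulLeft x).isOpenMap W hW
    obtain ⟨g, w, hw, hwg⟩ := hd.exists_mem_open hO ⟨_, mem_image_of_mem _ hv⟩
    -- The point `w` of `W` lies in the open set `x⁻¹ * S n`, so `e` takes a value near `w`.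
    obtain ⟨k, hkW, hkS⟩ := hd.exists_mem_open
      (hW.inter ((hSo n).preimage (continuous_const_mul x)))
      ⟨w, hw, show x * w ∈ S n from (show x * w = e g from hwg) ▸ hSr n g⟩
    exact ⟨k, hkW, hkS⟩
  have : Nonempty G := ⟨1⟩
  obtain ⟨g, hg⟩ := (dense_iInter_of_isOpen hopen hdense).nonempty
  obtain ⟨k, hk⟩ := mem_range_of_forall_exists_dist_lt he.continuous hd fun n ↦ mem_iInter.mp hg n
  exact ⟨k * g⁻¹, by rw [map_mul, map_inv, hk, mul_inv_cancel_right]⟩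

end Completeness

/-! ### Locally quasi-convex groups -/

/-- For a quasi-convex neighbourhood `U` of `1`, positivity on the compact set `polarSet U`
defines an open neighbourhood of `1` in the bidual whose preimage lies in `U`. -/
theorem isInducing_canonicalHom {G : Type*} [CommGroup G] [TopologicalSpace G]
    [IsTopologicalGroup G] (hc : Continuous (canonicalHom G)) (hG : IsLocallyQuasiConvex G) :
    IsInducing (canonicalHom G) := by
  rw [IsTopologicalGroup.isInducing_iff_nhds_one]
  refine le_antisymm ?_ ?_
  · rw [← tendsto_iff_comap]
    exact hc.tendsto' _ _ (map_one _)
  · refine hG.ge_iff.mpr fun U ⟨hU, hqc⟩ ↦ ?_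
    refine ⟨_, (isOpen_re_pos_of_isCompact (isCompact_polarSet hU)).mem_nhds fun χ _ ↦ by simp,
      fun g hg ↦ ?_⟩
    by_contra hgU
    obtain ⟨χ, hχ, hneg⟩ := hqc g hgU
    exact lt_asymm hneg (hg χ hχ)

theorem proposition3 (G : Type*) [CommGroup G] [TopologicalSpace G] [IsTopologicalGroup G]
    [PolishSpace G]
    (hG : closure (Set.range (canonicalHom G)) = Set.univ) :
    (IsReflexive (PontryaginDual G) ∧ IsReflexive (PontryaginDual (PontryaginDual G))) ∧
      (IsLocallyQuasiConvex G → IsReflexive G) := by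
  have hd : DenseRange (canonicalHom G) := dense_iff_closure_eq.mpr hG
  have hc : Continuous (canonicalHom G) := continuous_canonicalHom
  have hr := isReflexive_dual_of_denseRange hc hd continuous_canonicalHom_dual
  refine ⟨⟨hr, hr.dual⟩, fun hqc ↦ ?_⟩
  have hi := isInducing_canonicalHom hc hqc
  exact isHomeomorph_iff_isEmbedding_surjective.mpr
    ⟨hi.isEmbedding, surjective_of_isInducing_of_denseRange hi hd⟩
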